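/- Let $\mathbb D=\{z\in\mathbb C:|z|<1\}$ and let $f:\mathbb D\to\mathbb C$ be a harmonic mapping with canonical decomposition $f=h+\overline g$, where $h,g$ are analytic in $\mathbb D$, $g(z_0)=0$ for a fixed point $z_0\in\mathbb D$, and $|h'(z)|+|g'(z)|\neq0$ for all $z\in\mathbb D$. Suppose that its dilatation $\omega=g'/h'$ is the square, $\omega=q^2$, of a meromorphic function $q$ in $\mathbb D$. Let $$\widetilde f(z)=\Bigl(\operatorname{Re}f(z),\ \operatorname{Im}f(z),\ 2\operatorname{Im}\int_{z_0}^z h'(\zeta)q(\zeta)\,d\zeta\Bigr)\in\mathbb R^3$$ be the Weierstrass–Enneper lift of $f$, and put $$e^{\sigma}=|h'|+|g'|,\qquad K=-e^{-2\sigma}\Delta\sigma,\qquad \mathcal Sf=2(\sigma_{zz}-\sigma_z^2),$$ where $\partial_z=\tfrac12(\partial_x-i\partial_y)$ and $\partial_{\bar z}=\tfrac12(\partial_x+i\partial_y)$; thus $e^{2\sigma}|dz|^2$ is the first fundamental form and $K$ the Gauss curvature of the lifted surface. Let $\mathbf g=e^{2\rho}|dz|^2$, with $\rho:\mathbb D\to\mathbb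 R$ of class $C^2$, be a metric in $\mathbb D$ conformal to the Euclidean metric, and suppose that, for some $0<\delta\le\infty$, any two distinct points of $\mathbb D$ can be joined by a geodesic of $\mathbf g$ in $\mathbb D$ of $\mathbf g$-length less than $\delta$. If $$\bigl|\mathcal Sf-2(\rho_{zz}-\rho_z^2)\bigr|+e^{2\sigma}|K|\le\frac{2\pi^2e^{2\rho}}{\delta^2}+2\rho_{z\bar z}\qquad\text{everywhere in }\mathbb D$$ (where $1/\delta^2=0$ if $\delta=\infty$), then $\widetilde f$ is injective in $\mathbb D$. -/

import Mathlib

open scoped ENNReal Topology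

noncomputable section

namespace WELift

/-- The open unit disk `𝔻` as a subset of `ℂ`. -/
def disk : Set ℂ := Metric.ball 0 1

/-! ### Wirtinger derivatives -/

/-- `∂φ/∂z = (φ_x - i φ_y) / 2`. -/
def dz (φ : ℂ → ℂ) (z : ℂ) : ℂ :=
  (1 / 2) * (fderiv ℝ φ z 1 - Complex.I * fderiv ℝ φ z Complex.I)

/-- `∂φ/∂z̄ = (φ_x + i φ_y) / 2`. -/
def dzbar (φ : ℂ → ℂ) (z : ℂ) : ℂ :=
  (1 / 2) * (fderiv ℝ φ z 1 + Complex.I * fderiv ℝ φ z Complex.I)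

/-- A real-valued function regarded as a complex-valued one. -/
def toC (u : ℂ → ℝ) (z : ℂ) : ℂ := (u z : ℂ)

/-- The Schwarzian tensor `B(u) = 2 (u_zz - u_z²)` of a real function `u`, relative to the
Euclidean metric and identified with a complex number. -/
def schwarzianTensor (u : ℂ → ℝ) (z : ℂ) : ℂ :=
  2 * (dz (dz (toC u)) z - dz (toC u) z ^ 2)

/-- The mixed derivative `u_{z z̄}` of a real function `u`; it is real for `u` of class `C²`
(a quarter of the Laplacian), so that taking the real part loses nothing. -/
def mixedDeriv (u : ℂ → ℝ) (z : ℂ) : ℝ :=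
  (dzbar (dz (toC u)) z).re

/-! ### Harmonic mappings and their lifts -/

/-- `f = h + conj g` is the canonical decomposition of `f` on the disk: `h` and `g` are analytic
and `g` vanishes at the base point `z₀`. -/
structure IsCanonicalDecomposition (f h g : ℂ → ℂ) (z₀ : ℂ) : Prop where
  analytic_h : AnalyticOnNhd ℂ h disk
  analytic_g : AnalyticOnNhd ℂ g disk
  eq_add : ∀ z ∈ disk, f z = h z + (starRingEnd ℂ) (g z)
  base : g z₀ = 0

/-- Every complex-valued harmonic function on the disk has a canonical decomposition. -/
theorem exists_isCanonicalDecomposition {f : ℂ → ℂ}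
    (hf : InnerProductSpace.HarmonicOnNhd f disk) (z₀ : ℂ) :
    ∃ h g : ℂ → ℂ, IsCanonicalDecomposition f h g z₀ := by
  have h1 : InnerProductSpace.HarmonicOnNhd (Complex.reCLM ∘ f) disk := hf.comp_CLM _
  have h2 : InnerProductSpace.HarmonicOnNhd (Complex.imCLM ∘ f) disk := hf.comp_CLM _
  obtain ⟨F, hF, hFe⟩ := h1.exists_analyticOnNhd_ball_re_eq
  obtain ⟨G, hG, hGe⟩ := h2.exists_analyticOnNhd_ball_re_eq
  refine ⟨fun z ↦ (1 / 2) * (F z + Complex.I * G z)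
      + (starRingEnd ℂ) ((1 / 2) * (F z₀ - Complex.I * G z₀)),
    fun z ↦ (1 / 2) * (F z - Complex.I * G z) - (1 / 2) * (F z₀ - Complex.I * G z₀),
    ?_, ?_, ?_, by simp⟩
  · intro z hz
    have := hF z hz
    have := hG z hz
    fun_prop
  · intro z hz
    have := hF z hz
    have := hG z hz
    fun_prop
  · intro z hz
    have e1 : (F z).re = (f z).re := hFe hz
    have e2 : (G z).re = (f z).im := hGe hz
    apply Complex.ext
    · simp [← e1]; ring
    · simp [← e2]; ring

/-- The dilatation `ω = g' / h'` of `f = h + conj g`. -/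
def dilatation (h g : ℂ → ℂ) : ℂ → ℂ := fun z ↦ deriv g z / deriv h z

/-- `σ = log (|h'| + |g'|)`, so that `e^{2σ} |dz|²` is the first fundamental form of the lift. -/
def sigma (h g : ℂ → ℂ) (z : ℂ) : ℝ := Real.log (‖deriv h z‖ + ‖deriv g z‖)

/-- The Schwarzian derivative `S f = 2 (σ_zz - σ_z²)` of `f = h + conj g`. -/
def harmonicSchwarzian (h g : ℂ → ℂ) : ℂ → ℂ := schwarzianTensor (sigma h g)

/-- The Gauss curvature `K = - e^{-2σ} Δσ` of the lifted surface. -/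
def gaussCurvature (h g : ℂ → ℂ) (z : ℂ) : ℝ :=
  - Real.exp (-2 * sigma h g z) * Laplacian.laplacian (sigma h g) z

/-- The height `W(z) = 2 Im ∫ h' q dζ` of the lifted surface, the integral being taken over the
segment from `z₀` to `z`. (The poles of `q` are removable singularities of `h' q` in the situation
considered; a segment in the disk meets at most finitely many of them, so the values assigned to
`q` there do not matter.) -/
def height (h q : ℂ → ℂ) (z₀ z : ℂ) : ℝ :=
  2 * (∫ t in (0 : ℝ)..1,
    deriv h (z₀ + t * (z - z₀)) * q (z₀ + t * (z - z₀)) * (z - z₀)).im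

/-- The Weierstrass–Enneper lift `(Re f, Im f, W)`. -/
def lift (f h q : ℂ → ℂ) (z₀ z : ℂ) : EuclideanSpace ℝ (Fin 3) :=
  !₂[(f z).re, (f z).im, height h q z₀ z]

/-! ### Geodesics of the conformal metric `e^{2ρ} |dz|²` -/

/-- `γ : [0, 1] → 𝔻` is a (constant-speed parametrized) geodesic of `e^{2ρ} |dz|²`: it is `C²` and
solves the geodesic equation `γ'' + 2 ρ_z(γ) (γ')² = 0`. In real notation this is
`γ'' + 2 ⟨∇ρ, γ'⟩ γ' - |γ'|² ∇ρ = 0`, the Christoffel symbols of the metric being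
`Γᵏᵢⱼ = δᵏᵢ ∂ⱼρ + δᵏⱼ ∂ᵢρ - δᵢⱼ ∂ₖρ`. -/
structure IsGeodesic (ρ : ℂ → ℝ) (γ : ℝ → ℂ) : Prop where
  contDiffOn : ContDiffOn ℝ 2 γ (Set.Icc 0 1)
  mem_disk : ∀ t ∈ Set.Icc (0 : ℝ) 1, γ t ∈ disk
  equation : ∀ t ∈ Set.Icc (0 : ℝ) 1,
    derivWithin (derivWithin γ (Set.Icc 0 1)) (Set.Icc 0 1) t
      + 2 * dz (toC ρ) (γ t) * derivWithin γ (Set.Icc 0 1) t ^ 2 = 0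

/-- The length `∫ e^{ρ(γ)} |γ'| dt` of `γ : [0, 1] → 𝔻` in the metric `e^{2ρ} |dz|²`. -/
def conformalLength (ρ : ℂ → ℝ) (γ : ℝ → ℂ) : ℝ≥0∞ :=
  ∫⁻ t in Set.Icc (0 : ℝ) 1,
    ENNReal.ofReal (Real.exp (ρ (γ t)) * ‖derivWithin γ (Set.Icc 0 1) t‖)

/-- Any two distinct points of the disk are joined by a geodesic of `e^{2ρ} |dz|²` of length less
than `δ`. -/
def JoinedByGeodesics (ρ : ℂ → ℝ) (δ : ℝ≥0∞) : Prop :=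
  ∀ z₁ ∈ disk, ∀ z₂ ∈ disk, z₁ ≠ z₂ →
    ∃ γ : ℝ → ℂ, IsGeodesic ρ γ ∧ γ 0 = z₁ ∧ γ 1 = z₂ ∧ conformalLength ρ γ < δ

end WELift

end

noncomputable section

namespace WELift

open ComplexConjugate

/-! The lift is restricted to a geodesic `γ` of the metric joining two given points, and the
resulting space curve `Φ` is shown not to close up. With `l = log |Φ'|` and `A = Φ'' - l' Φ'`, the
part of the acceleration normal to `Φ'`, the Ahlfors Schwarzian of the curve is `l'' - l'²/2 +
(|A|/|Φ'|)²/2`.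

If it is at most `2P`, then `y = |Φ - Φ 0| e^{-l/2}` satisfies `y'' + P y ≥ 0` wherever it is
positive. For `P < π²`, Sturm comparison with a sine forbids `y` to vanish at both ends of `[0, 1]`
(`ne_of_curve_schwarzian_le`).

To estimate the Schwarzian, write locally `h' = a²`, `g' = b²`, `h' q = a b`, so that `e^σ = |a|² +
|b|²` and `σ_{z z̄} = |m|²` with `m = (a b' - a' b) / e^σ`. The normal acceleration splits into a
geodesic and a normal curvature term, the latter controlled by `|m|` (`curvature_sq_le`). By the
geodesic equation all first-order terms combine (`schwarzian_algebra`), leaving the bound `|Sf -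
2(ρ_zz - ρ_z²)| |γ'|² + (4σ_{z z̄} - 2ρ_{z z̄}) |γ'|²`. Since `4σ_{z z̄} = e^{2σ}|K|`, the
hypothesis bounds this by `2π² e^{2ρ}|γ'|²/δ² = 2π²c²/δ²`, where `c < δ` is the constant speed,
hence the length, of `γ`. -/

theorem second_deriv_nonpos_of_isLocalMax {f f' : ℝ → ℝ} {d x : ℝ}
    (hf : ∀ᶠ t in 𝓝 x, HasDerivAt f (f' t) t) (hf' : HasDerivAt f' d x)
    (hmax : IsLocalMax f x) : d ≤ 0 := by
  by_contra! hd
  have e : deriv f =ᶠ[𝓝 x] f' := hf.mono fun t ht ↦ ht.deriv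
  have h2 : deriv (deriv f) x = d := by rw [e.deriv_eq, hf'.deriv]
  -- If `d > 0`, the point is also a local minimum, so `f` is locally constant and `d = 0`.
  have h1 : deriv f x = 0 := hmax.deriv_eq_zero
  have hmin : IsLocalMin f x :=
    isLocalMin_of_deriv_deriv_pos (by rw [h2]; exact hd) h1 hf.self_of_nhds.continuousAt
  have hc : f =ᶠ[𝓝 x] fun _ ↦ f x := by
    filter_upwards [hmax, hmin] with t h3 h4 using le_antisymm h3 h4
  have h5 : deriv (deriv f) x = 0 := by
    rw [hc.deriv.deriv_eq]; simp
  linarith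

/-! ### Sturm comparison for curves in an inner product space -/

section Curve

variable {E : Type*} [NormedAddCommGroup E] [InnerProductSpace ℝ E]

/-- Completing the square: with `X⊥` the part of `X` normal to `T` and `κ = A / ‖T‖²` the curvature
vector, the inequality is `‖X⊥ + ‖X‖² κ / 2‖² ≥ 0`. Circles through the origin give equality. -/
theorem neg_curvature_sq_le (X T A : E) (hX : 0 < ‖X‖) (hT : 0 < ‖T‖) (hA : inner ℝ T A = 0) :
    -(1 / 4) * (‖A‖ / ‖T‖) ^ 2 ≤
      ‖T‖ ^ 2 / ‖X‖ ^ 2 + inner ℝ X A / ‖X‖ ^ 2 - (inner ℝ X T) ^ 2 / (‖X‖ ^ 2) ^ 2 := by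
  have key : 0 ≤ ‖‖T‖ • X - (inner ℝ X T / ‖T‖) • T + (‖X‖ ^ 2 / (2 * ‖T‖)) • A‖ ^ 2 := by
    positivity
  have e : ‖‖T‖ • X - (inner ℝ X T / ‖T‖) • T + (‖X‖ ^ 2 / (2 * ‖T‖)) • A‖ ^ 2 =
      (‖X‖ ^ 2) ^ 2 * (‖T‖ ^ 2 / ‖X‖ ^ 2 + inner ℝ X A / ‖X‖ ^ 2
        - (inner ℝ X T) ^ 2 / (‖X‖ ^ 2) ^ 2 + 1 / 4 * (‖A‖ / ‖T‖) ^ 2) := by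
    have c1 : inner ℝ A X = inner ℝ X A := real_inner_comm _ _
    have c2 : inner ℝ T X = inner ℝ X T := real_inner_comm _ _
    have c3 : inner ℝ A T = 0 := by rw [real_inner_comm, hA]
    rw [← real_inner_self_eq_norm_sq]
    simp only [inner_add_left, inner_add_right, inner_sub_left, inner_sub_right,
      real_inner_smul_left, real_inner_smul_right, real_inner_self_eq_norm_sq, hA, c1, c2, c3,
      norm_smul, mul_pow, Real.norm_eq_abs, sq_abs]
    field_simp
    ring
  rw [e] at key
  have : 0 < (‖X‖ ^ 2) ^ 2 := by positivity
  have := nonneg_of_mul_nonneg_right key this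
  linarith

/-- A curve whose Ahlfors Schwarzian is less than `2π²` on an interval of length one does not
close up. -/
theorem ne_of_curve_schwarzian_le {Φ Φ' Φ'' : ℝ → E} {l l' l'' : ℝ → ℝ} {P : ℝ}
    (hP : P < Real.pi ^ 2)
    (hΦc : ContinuousOn Φ (Set.Icc 0 1)) (hlc : ContinuousOn l (Set.Icc 0 1))
    (hΦ : ∀ t ∈ Set.Ioo (0 : ℝ) 1, HasDerivAt Φ (Φ' t) t)
    (hΦ' : ∀ t ∈ Set.Ioo (0 : ℝ) 1, HasDerivAt Φ' (Φ'' t) t)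
    (hl : ∀ t ∈ Set.Ioo (0 : ℝ) 1, HasDerivAt l (l' t) t)
    (hl' : ∀ t ∈ Set.Ioo (0 : ℝ) 1, HasDerivAt l' (l'' t) t)
    (hn : ∀ t ∈ Set.Ioo (0 : ℝ) 1, ‖Φ' t‖ = Real.exp (l t))
    (hS : ∀ t ∈ Set.Ioo (0 : ℝ) 1,
      l'' t - 1 / 2 * l' t ^ 2 + 1 / 2 * (‖Φ'' t - l' t • Φ' t‖ / ‖Φ' t‖) ^ 2 ≤ 2 * P) :
    Φ 0 ≠ Φ 1 := by
  intro h01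
  -- `P` may be negative, hence the maximum with `0`.
  obtain ⟨ω, hω0, hωP, hωpi⟩ : ∃ ω : ℝ, 0 < ω ∧ P < ω ^ 2 ∧ ω < Real.pi := by
    have hm : max P 0 < Real.pi ^ 2 := max_lt hP (by positivity)
    obtain ⟨x, hx1, hx2⟩ := exists_between hm
    have hx0 : 0 < x := (le_max_right _ _).trans_lt hx1
    refine ⟨√x, Real.sqrt_pos.2 hx0, ?_, ?_⟩
    · rw [Real.sq_sqrt hx0.le]; exact (le_max_left _ _).trans_lt hx1
    · exact (Real.sqrt_lt' Real.pi_pos).2 hx2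
  -- This phase centres `[ε, ω + ε]` in `(0, π)`, so the sine is positive on the closed interval.
  set ε : ℝ := (Real.pi - ω) / 2 with hε
  set w : ℝ → ℝ := fun t ↦ Real.sin (ω * t + ε) with hw
  have hwpos : ∀ t ∈ Set.Icc (0 : ℝ) 1, 0 < w t := by
    intro t ht
    apply Real.sin_pos_of_pos_of_lt_pi
    · have := mul_nonneg hω0.le ht.1; linarith
    · have := mul_le_mul_of_nonneg_left ht.2 hω0.le; linarith
  set X : ℝ → E := fun t ↦ Φ t - Φ 0 with hX
  -- `G = (y / w)²` with `y = ‖X‖ e^{-l/2}`. It vanishes at both ends if the curve closes up, so its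
  -- maximum is interior; there the second derivative test is applied to `Q = log G`.
  set G : ℝ → ℝ := fun t ↦ ‖X t‖ ^ 2 * Real.exp (-l t) / w t ^ 2 with hG
  have hGc : ContinuousOn G (Set.Icc 0 1) := by
    apply ContinuousOn.div
    · exact ((hΦc.sub continuousOn_const).norm.pow 2).mul hlc.neg.rexp
    · fun_prop
    · intro t ht; have := hwpos t ht; positivity
  obtain ⟨s, hs, hsX⟩ : ∃ s ∈ Set.Ioo (0 : ℝ) 1, X s ≠ 0 := by
    by_contra! hcon
    have hmem : (1 / 2 : ℝ) ∈ Set.Ioo (0 : ℝ) 1 := by constructor <;> norm_num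
    have e : Φ =ᶠ[𝓝 (1 / 2 : ℝ)] fun _ ↦ Φ 0 := by
      filter_upwards [isOpen_Ioo.mem_nhds hmem] with t ht
      exact sub_eq_zero.1 (hcon t ht)
    have h0 : Φ' (1 / 2) = 0 := by
      rw [← (hΦ _ hmem).deriv, e.deriv_eq]; simp
    have := hn _ hmem
    rw [h0, norm_zero] at this
    exact (Real.exp_pos _).ne this
  obtain ⟨t₀, ht₀, hmax⟩ := isCompact_Icc.exists_isMaxOn ⟨s, Set.Ioo_subset_Icc_self hs⟩ hGc
  have hGs : 0 < G s := by
    have := hwpos s (Set.Ioo_subset_Icc_self hs)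
    have := norm_pos_iff.2 hsX
    positivity
  have hGt : 0 < G t₀ := hGs.trans_le (hmax (Set.Ioo_subset_Icc_self hs))
  have hXt : X t₀ ≠ 0 := by
    intro h0
    simp [hG, h0] at hGt
  have ht : t₀ ∈ Set.Ioo (0 : ℝ) 1 := by
    refine ⟨lt_of_le_of_ne ht₀.1 ?_, lt_of_le_of_ne ht₀.2 ?_⟩
    · rintro rfl; exact hXt (by simp [hX])
    · rintro rfl; exact hXt (by simp [hX, h01])
  have hev : ∀ᶠ t in 𝓝 t₀, t ∈ Set.Ioo (0 : ℝ) 1 := isOpen_Ioo.mem_nhds ht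
  have hXd : ∀ t ∈ Set.Ioo (0 : ℝ) 1, HasDerivAt X (Φ' t) t := fun t ht ↦ (hΦ t ht).sub_const _
  have hXev : ∀ᶠ t in 𝓝 t₀, X t ≠ 0 :=
    (hXd t₀ ht).continuousAt.eventually_ne hXt
  set Q : ℝ → ℝ := fun t ↦ Real.log (‖X t‖ ^ 2) - l t - 2 * Real.log (w t) with hQ
  set Q' : ℝ → ℝ := fun t ↦ 2 * inner ℝ (X t) (Φ' t) / ‖X t‖ ^ 2 - l' t
    - 2 * (Real.cos (ω * t + ε) * ω / w t) with hQ'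
  have hwd : ∀ t, HasDerivAt w (Real.cos (ω * t + ε) * ω) t := fun t ↦ by
    have := ((hasDerivAt_id t).const_mul ω).add_const ε
    simpa using this.sin
  have hNd : ∀ t ∈ Set.Ioo (0 : ℝ) 1,
      HasDerivAt (fun t ↦ ‖X t‖ ^ 2) (2 * inner ℝ (X t) (Φ' t)) t := fun t ht ↦ (hXd t ht).norm_sq
  have hQd : ∀ᶠ t in 𝓝 t₀, HasDerivAt Q (Q' t) t := by
    filter_upwards [hev, hXev] with t ht hx
    have hN0 : ‖X t‖ ^ 2 ≠ 0 := by positivity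
    exact (((hNd t ht).log hN0).sub (hl t ht)).sub
      (((hwd t).log (hwpos t (Set.Ioo_subset_Icc_self ht)).ne').const_mul 2)
  have hlocmax : IsLocalMax Q t₀ := by
    have e : ∀ t ∈ Set.Ioo (0 : ℝ) 1, X t ≠ 0 → Q t = Real.log (G t) := by
      intro t ht hx
      have := hwpos t (Set.Ioo_subset_Icc_self ht)
      have h1 : ‖X t‖ ^ 2 ≠ 0 := by positivity
      rw [hG, hQ]
      simp only
      rw [Real.log_div (by positivity) (by positivity), Real.log_mul h1 (by positivity),
        Real.log_exp, Real.log_pow (n := 2) (x := w t)]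
      push_cast
      ring
    filter_upwards [hev, hXev] with t ht' hx
    rw [e t ht' hx, e t₀ ht hXt]
    apply Real.log_le_log
    · have := hwpos t (Set.Ioo_subset_Icc_self ht')
      have := norm_pos_iff.2 hx
      positivity
    · exact hmax (Set.Ioo_subset_Icc_self ht')
  have hw0 := hwpos t₀ ht₀
  have hN0 : ‖X t₀‖ ^ 2 ≠ 0 := by positivity
  have hQ0 : Q' t₀ = 0 := by
    rw [← hQd.self_of_nhds.deriv]; exact hlocmax.deriv_eq_zero
  have hcd : HasDerivAt (fun t ↦ Real.cos (ω * t + ε) * ω)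
      (-Real.sin (ω * t₀ + ε) * ω * ω) t₀ := by
    have := ((hasDerivAt_id t₀).const_mul ω).add_const ε
    simpa using (this.cos).mul_const ω
  have hQd2 := ((((((hXd t₀ ht).inner ℝ (hΦ' t₀ ht)).const_mul 2).div (hNd t₀ ht) hN0).sub
    (hl' t₀ ht)).sub ((hcd.div (hwd t₀) hw0.ne').const_mul 2))
  have hle := second_deriv_nonpos_of_isLocalMax hQd hQd2 hlocmax
  -- Differentiate `‖Φ'‖² = e^{2l}`.
  have horth : inner ℝ (Φ' t₀) (Φ'' t₀ - l' t₀ • Φ' t₀) = 0 := by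
    have e : (fun t ↦ ‖Φ' t‖ ^ 2) =ᶠ[𝓝 t₀] fun t ↦ Real.exp (l t) ^ 2 := by
      filter_upwards [hev] with t ht
      rw [hn t ht]
    have d1 := ((hΦ' t₀ ht).norm_sq).deriv
    have d2 := ((hl t₀ ht).exp.pow 2).deriv
    change deriv (fun t ↦ Real.exp (l t) ^ 2) t₀ = _ at d2
    rw [e.deriv_eq, d2] at d1
    rw [inner_sub_right, real_inner_smul_right, real_inner_self_eq_norm_sq, hn t₀ ht]
    push_cast at d1
    linear_combination -d1 / 2
  have hT : 0 < ‖Φ' t₀‖ := by rw [hn t₀ ht]; exact Real.exp_pos _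
  have hkey := neg_curvature_sq_le (X t₀) (Φ' t₀) _ (norm_pos_iff.2 hXt) hT horth
  have hSt := hS t₀ ht
  set A := Φ'' t₀ - l' t₀ • Φ' t₀ with hA
  have hΦA : Φ'' t₀ = A + l' t₀ • Φ' t₀ := by rw [hA]; abel
  rw [hΦA, inner_add_right, real_inner_smul_right, real_inner_self_eq_norm_sq] at hle
  simp only [hQ'] at hQ0
  set N := ‖X t₀‖ ^ 2
  set m := inner ℝ (X t₀) (Φ' t₀)
  set k := inner ℝ (X t₀) A
  set v := ‖Φ' t₀‖
  set c := Real.cos (ω * t₀ + ε) * ω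
  have hsin : Real.sin (ω * t₀ + ε) = w t₀ := rfl
  rw [hsin] at hle
  -- The critical point equation `Q' = 0`; it eliminates the cosine from `Q''`.
  have hc : c / w t₀ = m / N - l' t₀ / 2 := by
    have : 2 * m / N = 2 * (m / N) := by ring
    linarith
  have e1 : (-w t₀ * ω * ω * w t₀ - c * c) / w t₀ ^ 2 = -ω ^ 2 - (c / w t₀) ^ 2 := by
    field_simp
  rw [e1, hc] at hle
  have e2 : (2 * (k + l' t₀ * m + v ^ 2) * N - 2 * m * (2 * m)) / N ^ 2
      = 2 * (k / N) + 2 * l' t₀ * (m / N) + 2 * (v ^ 2 / N) - 4 * (m ^ 2 / N ^ 2) := by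
    field_simp
    ring
  rw [e2] at hle
  have e3 : (m / N) ^ 2 = m ^ 2 / N ^ 2 := by ring
  -- Together these give `Q'' ≥ 2ω² - 2P > 0` at the maximum.
  nlinarith [hle, hkey, hSt, e3, hωP]

end Curve

/-! ### Wirtinger calculus -/

/-- The real-differentiable function `φ` has Wirtinger derivatives `∂φ/∂z = A`, `∂φ/∂z̄ = B`. -/
def HasWirtingerAt (φ : ℂ → ℂ) (A B z : ℂ) : Prop :=
  HasFDerivAt φ (A • ContinuousLinearMap.id ℝ ℂ + B • (Complex.conjCLE : ℂ →L[ℝ] ℂ)) z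

namespace HasWirtingerAt

variable {φ ψ : ℂ → ℂ} {A B C D z : ℂ}

theorem dz_eq (h : HasWirtingerAt φ A B z) : dz φ z = A := by
  rw [dz, HasFDerivAt.fderiv h]
  simp [mul_add, mul_sub, ← mul_assoc]
  ring_nf
  simp
  ring

theorem dzbar_eq (h : HasWirtingerAt φ A B z) : dzbar φ z = B := by
  rw [dzbar, HasFDerivAt.fderiv h]
  simp [mul_add, ← mul_assoc]
  ring_nf
  simp
  ring

theorem of_differentiableAt (h : DifferentiableAt ℝ φ z) :
    HasWirtingerAt φ (dz φ z) (dzbar φ z) z := by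
  rw [HasWirtingerAt]
  convert h.hasFDerivAt using 1
  ext x
  have hx : x = x.re • (1 : ℂ) + x.im • Complex.I := by simp
  have e : fderiv ℝ φ z x = x.re * fderiv ℝ φ z 1 + x.im * fderiv ℝ φ z Complex.I := by
    conv_lhs => rw [hx, map_add, map_smul, map_smul]
    simp
  have hc : conj x = x.re - x.im * Complex.I := by
    apply Complex.ext <;> simp
  have hx' : x = x.re + x.im * Complex.I := by simp
  simp only [dz, dzbar, add_apply, smul_apply,
    ContinuousLinearMap.id_apply, ContinuousLinearEquiv.coe_coe, Complex.conjCLE_apply,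
    smul_eq_mul, e, hc]
  conv_lhs => enter [1, 2]; rw [hx']
  linear_combination (-(x.im : ℂ) * fderiv ℝ φ z Complex.I) * Complex.I_sq

theorem congr_of_eventuallyEq (h : HasWirtingerAt φ A B z) (e : ψ =ᶠ[𝓝 z] φ) :
    HasWirtingerAt ψ A B z :=
  HasFDerivAt.congr_of_eventuallyEq h e

theorem of_hasDerivAt (h : HasDerivAt φ A z) : HasWirtingerAt φ A 0 z := by
  rw [HasWirtingerAt]
  refine HasFDerivAt.congr_fderiv (h.hasFDerivAt.restrictScalars ℝ) ?_
  refine ContinuousLinearMap.ext fun x ↦ ?_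
  simp [mul_comm]

theorem star (h : HasWirtingerAt φ A B z) :
    HasWirtingerAt (fun w ↦ conj (φ w)) (conj B) (conj A) z := by
  rw [HasWirtingerAt] at *
  refine HasFDerivAt.congr_fderiv ((Complex.conjCLE : ℂ →L[ℝ] ℂ).hasFDerivAt.comp z h) ?_
  refine ContinuousLinearMap.ext fun x ↦ ?_
  simp [add_comm]

theorem add (h : HasWirtingerAt φ A B z) (k : HasWirtingerAt ψ C D z) :
    HasWirtingerAt (fun w ↦ φ w + ψ w) (A + C) (B + D) z := by
  rw [HasWirtingerAt] at *
  refine HasFDerivAt.congr_fderiv (HasFDerivAt.add h k) ?_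
  refine ContinuousLinearMap.ext fun x ↦ ?_
  simp
  ring

theorem mul (h : HasWirtingerAt φ A B z) (k : HasWirtingerAt ψ C D z) :
    HasWirtingerAt (fun w ↦ φ w * ψ w) (A * ψ z + φ z * C) (B * ψ z + φ z * D) z := by
  rw [HasWirtingerAt] at *
  refine HasFDerivAt.congr_fderiv (HasFDerivAt.mul h k) ?_
  refine ContinuousLinearMap.ext fun x ↦ ?_
  simp
  ring

theorem comp_holomorphic {F : ℂ → ℂ} {F' : ℂ} (hF : HasDerivAt F F' (φ z))
    (h : HasWirtingerAt φ A B z) : HasWirtingerAt (fun w ↦ F (φ w)) (F' * A) (F' * B) z := by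
  rw [HasWirtingerAt] at *
  refine HasFDerivAt.congr_fderiv ((hF.hasFDerivAt.restrictScalars ℝ).comp z h) ?_
  refine ContinuousLinearMap.ext fun x ↦ ?_
  simp
  ring

theorem comp_curve {γ : ℝ → ℂ} {ζ : ℂ} {t : ℝ} (h : HasWirtingerAt φ A B (γ t))
    (hγ : HasDerivAt γ ζ t) : HasDerivAt (fun s ↦ φ (γ s)) (A * ζ + B * conj ζ) t := by
  rw [HasWirtingerAt] at h
  exact HasDerivAt.congr_deriv (h.comp_hasDerivAt t hγ) (by simp)

end HasWirtingerAt

/-! ### Real functions: Wirtinger derivatives and restriction to curves -/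

section RealFunction

variable {u : ℂ → ℝ} {z : ℂ}

theorem dz_toC_eq (h : DifferentiableAt ℝ u z) :
    dz (toC u) z = (1 / 2) * ((fderiv ℝ u z 1 : ℂ) - Complex.I * (fderiv ℝ u z Complex.I : ℂ)) := by
  have e : HasFDerivAt (toC u) (Complex.ofRealCLM.comp (fderiv ℝ u z)) z :=
    Complex.ofRealCLM.hasFDerivAt.comp z h.hasFDerivAt
  rw [dz, e.fderiv]
  simp

theorem hasWirtingerAt_toC (h : DifferentiableAt ℝ u z) :
    HasWirtingerAt (toC u) (dz (toC u) z) (conj (dz (toC u) z)) z := by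
  have e : HasFDerivAt (toC u) (Complex.ofRealCLM.comp (fderiv ℝ u z)) z :=
    Complex.ofRealCLM.hasFDerivAt.comp z h.hasFDerivAt
  have k : dzbar (toC u) z = conj (dz (toC u) z) := by
    rw [dz_toC_eq h, dzbar, e.fderiv]
    simp [Complex.conj_ofNat]
  rw [← k]
  exact .of_differentiableAt e.differentiableAt

theorem dz_toC_eventuallyEq (h : ContDiffAt ℝ 2 u z) :
    dz (toC u) =ᶠ[𝓝 z] fun w ↦
      (1 / 2) * ((fderiv ℝ u w 1 : ℂ) - Complex.I * (fderiv ℝ u w Complex.I : ℂ)) := by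
  filter_upwards [h.eventually (by simp)] with w hw
  exact dz_toC_eq (hw.differentiableAt (by simp))

theorem hasFDerivAt_dz_toC (h : ContDiffAt ℝ 2 u z) :
    ∃ L : ℂ →L[ℝ] ℂ, HasFDerivAt (dz (toC u)) L z ∧ ∀ ξ, L ξ = (1 / 2) *
      ((fderiv ℝ (fderiv ℝ u) z ξ 1 : ℂ) - Complex.I * (fderiv ℝ (fderiv ℝ u) z ξ Complex.I : ℂ)) := by
  have hd : HasFDerivAt (fderiv ℝ u) (fderiv ℝ (fderiv ℝ u) z) z :=
    ((h.fderiv_right (m := 1) (by norm_num)).differentiableAt (by simp)).hasFDerivAt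
  have h1 : ∀ v : ℂ, HasFDerivAt (fun w ↦ (fderiv ℝ u w v : ℂ))
      (Complex.ofRealCLM.comp ((ContinuousLinearMap.apply ℝ ℝ v).comp
        (fderiv ℝ (fderiv ℝ u) z))) z := fun v ↦
    Complex.ofRealCLM.hasFDerivAt.comp z
      ((ContinuousLinearMap.apply ℝ ℝ v).hasFDerivAt.comp z hd)
  refine ⟨_, ((((h1 1).sub ((h1 Complex.I).const_mul Complex.I)).const_mul
    (1 / 2 : ℂ)).congr_of_eventuallyEq (dz_toC_eventuallyEq h)), fun ξ ↦ ?_⟩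
  simp

theorem differentiableAt_dz_toC (h : ContDiffAt ℝ 2 u z) :
    DifferentiableAt ℝ (dz (toC u)) z :=
  let ⟨_, hL, _⟩ := hasFDerivAt_dz_toC h
  hL.differentiableAt

theorem laplacian_eq_four_mul_mixedDeriv (h : ContDiffAt ℝ 2 u z) :
    Laplacian.laplacian u z = 4 * mixedDeriv u z := by
  obtain ⟨L, hL, hLe⟩ := hasFDerivAt_dz_toC h
  rw [InnerProductSpace.laplacian_eq_iteratedFDeriv_complexPlane, mixedDeriv, dzbar, hL.fderiv,
    hLe, hLe]
  simp only [iteratedFDeriv_two_apply]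
  simp
  ring

variable {γ : ℝ → ℂ} {γ' : ℝ → ℂ} {γ'' : ℂ} {t : ℝ}

theorem hasDerivAt_comp_curve (h : DifferentiableAt ℝ u (γ t)) (hγ : HasDerivAt γ (γ' t) t) :
    HasDerivAt (fun s ↦ u (γ s)) (2 * (dz (toC u) (γ t) * γ' t).re) t := by
  have := (hasWirtingerAt_toC h).comp_curve hγ
  refine HasDerivAt.congr_deriv (Complex.reCLM.hasFDerivAt.comp_hasDerivAt t this) ?_
  simp
  ring

theorem hasDerivAt_deriv_comp_curve (h : ContDiffAt ℝ 2 u (γ t)) (hγ : HasDerivAt γ (γ' t) t)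
    (hγ' : HasDerivAt γ' γ'' t) :
    HasDerivAt (fun s ↦ 2 * (dz (toC u) (γ s) * γ' s).re)
      (2 * (dz (dz (toC u)) (γ t) * γ' t ^ 2 + dz (toC u) (γ t) * γ'').re
        + 2 * mixedDeriv u (γ t) * ‖γ' t‖ ^ 2) t := by
  have h1 := (HasWirtingerAt.of_differentiableAt (differentiableAt_dz_toC h)).comp_curve hγ
  refine HasDerivAt.congr_deriv
    ((Complex.reCLM.hasFDerivAt.comp_hasDerivAt t (h1.mul hγ')).const_mul 2) ?_
  simp only [mixedDeriv]
  rw [← Complex.normSq_eq_norm_sq, Complex.normSq_apply]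
  simp [pow_two]
  ring

end RealFunction

/-! ### The logarithm of `|a|² + |b|²` for holomorphic `a`, `b` -/

section Spinor

variable {a b : ℂ → ℂ} {z : ℂ} {s : ℂ → ℝ}

/-- `|a|² + |b|²`, as a complex number. -/
def spinorEnergy (a b : ℂ → ℂ) (w : ℂ) : ℂ := a w * conj (a w) + b w * conj (b w)

theorem spinorEnergy_eq (a b : ℂ → ℂ) (w : ℂ) :
    spinorEnergy a b w = ((‖a w‖ ^ 2 + ‖b w‖ ^ 2 : ℝ) : ℂ) := by
  rw [spinorEnergy, Complex.mul_conj, Complex.mul_conj, Complex.normSq_eq_norm_sq,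
    Complex.normSq_eq_norm_sq]
  push_cast
  rfl

theorem hasWirtingerAt_spinorEnergy (ha : DifferentiableAt ℂ a z) (hb : DifferentiableAt ℂ b z) :
    HasWirtingerAt (spinorEnergy a b) (deriv a z * conj (a z) + deriv b z * conj (b z))
      (a z * conj (deriv a z) + b z * conj (deriv b z)) z := by
  have h1 := HasWirtingerAt.of_hasDerivAt ha.hasDerivAt
  have h2 := HasWirtingerAt.of_hasDerivAt hb.hasDerivAt
  have := (h1.mul h1.star).add (h2.mul h2.star)
  simpa only [map_zero, mul_zero, add_zero, zero_mul, zero_add] using! this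

theorem spinorEnergy_pos_iff : 0 < ‖a z‖ ^ 2 + ‖b z‖ ^ 2 ↔ spinorEnergy a b z ≠ 0 := by
  rw [spinorEnergy_eq, Complex.ofReal_ne_zero]
  have : 0 ≤ ‖a z‖ ^ 2 + ‖b z‖ ^ 2 := by positivity
  exact this.lt_iff_ne'

/-- `∂/∂z log (|a|² + |b|²)` for holomorphic `a`, `b`. -/
theorem dz_toC_log_energy (ha : DifferentiableAt ℂ a z) (hb : DifferentiableAt ℂ b z)
    (h0 : spinorEnergy a b z ≠ 0)
    (hs : s =ᶠ[𝓝 z] fun w ↦ Real.log (‖a w‖ ^ 2 + ‖b w‖ ^ 2)) :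
    dz (toC s) z = (deriv a z * conj (a z) + deriv b z * conj (b z)) / spinorEnergy a b z := by
  have hpos := spinorEnergy_pos_iff.2 h0
  have e : toC s =ᶠ[𝓝 z] fun w ↦ Complex.log (spinorEnergy a b w) := by
    filter_upwards [hs] with w hw
    rw [toC, hw, spinorEnergy_eq, ← Complex.ofReal_log (by positivity)]
  have hslit : spinorEnergy a b z ∈ Complex.slitPlane := by
    rw [spinorEnergy_eq, Complex.ofReal_mem_slitPlane]; exact hpos
  have := ((hasWirtingerAt_spinorEnergy ha hb).comp_holomorphic
    (Complex.hasDerivAt_log hslit)).congr_of_eventuallyEq e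
  rw [this.dz_eq, div_eq_inv_mul]

theorem contDiffAt_log_energy (ha : AnalyticAt ℂ a z) (hb : AnalyticAt ℂ b z)
    (h0 : spinorEnergy a b z ≠ 0)
    (hs : s =ᶠ[𝓝 z] fun w ↦ Real.log (‖a w‖ ^ 2 + ‖b w‖ ^ 2)) : ContDiffAt ℝ 2 s z := by
  have hpos := spinorEnergy_pos_iff.2 h0
  have h1 : ContDiffAt ℝ 2 a z := ha.contDiffAt.restrict_scalars ℝ
  have h2 : ContDiffAt ℝ 2 b z := hb.contDiffAt.restrict_scalars ℝ
  exact (((h1.norm_sq ℝ).add (h2.norm_sq ℝ)).log hpos.ne').congr_of_eventuallyEq hs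

/-- `∂²/∂z∂z̄ log (|a|² + |b|²)` for holomorphic `a`, `b`. -/
theorem mixedDeriv_log_energy (ha : AnalyticAt ℂ a z) (hb : AnalyticAt ℂ b z)
    (h0 : spinorEnergy a b z ≠ 0)
    (hs : s =ᶠ[𝓝 z] fun w ↦ Real.log (‖a w‖ ^ 2 + ‖b w‖ ^ 2)) :
    mixedDeriv s z = ‖(a z * deriv b z - deriv a z * b z) / spinorEnergy a b z‖ ^ 2 := by
  have hr := hasWirtingerAt_spinorEnergy ha.differentiableAt hb.differentiableAt
  have e : dz (toC s) =ᶠ[𝓝 z] fun w ↦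
      (deriv a w * conj (a w) + deriv b w * conj (b w)) * (spinorEnergy a b w)⁻¹ := by
    filter_upwards [ha.eventually_analyticAt, hb.eventually_analyticAt,
      hs.eventually_nhds, (HasFDerivAt.continuousAt hr).eventually_ne h0] with w h1 h2 h3 h4
    rw [dz_toC_log_energy h1.differentiableAt h2.differentiableAt h4 h3, div_eq_mul_inv]
  have h1 := HasWirtingerAt.of_hasDerivAt ha.differentiableAt.hasDerivAt
  have h2 := HasWirtingerAt.of_hasDerivAt hb.differentiableAt.hasDerivAt
  have h3 := HasWirtingerAt.of_hasDerivAt ha.deriv.differentiableAt.hasDerivAt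
  have h4 := HasWirtingerAt.of_hasDerivAt hb.deriv.differentiableAt.hasDerivAt
  have := ((((h3.mul h1.star).add (h4.mul h2.star)).mul
    (hr.comp_holomorphic (hasDerivAt_inv h0)))).congr_of_eventuallyEq e
  rw [mixedDeriv, this.dzbar_eq, ← Complex.normSq_eq_norm_sq, ← Complex.ofReal_re (Complex.normSq _),
    ← Complex.mul_conj]
  congr 1
  have hc : conj (spinorEnergy a b z) = spinorEnergy a b z := by
    rw [spinorEnergy_eq, Complex.conj_ofReal]
  rw [map_div₀, hc]
  simp only [map_sub, map_mul]
  -- What remains is Lagrange's identity `(|a|² + |b|²)(|a'|² + |b'|²) - |a' ā + b' b̄|² = |a b' -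
  -- a' b|²`.
  field_simp
  rw [spinorEnergy]
  ring

end Spinor

/-! ### Removing the poles of `h' q`, the height, and local square roots -/

theorem isOpen_disk : IsOpen disk := Metric.isOpen_ball

/-- If a meromorphic function has an analytic square, its singularities are removable. -/
theorem exists_analyticOnNhd_of_sq_eventuallyEq {U : Set ℂ} {k F : ℂ → ℂ}
    (hk : MeromorphicOn k U) (hF : AnalyticOnNhd ℂ F U)
    (h : ∀ z ∈ U, ∀ᶠ w in 𝓝[≠] z, k w ^ 2 = F w) :
    ∃ p : ℂ → ℂ, AnalyticOnNhd ℂ p U ∧ (∀ z ∈ U, p =ᶠ[𝓝[≠] z] k) ∧ ∀ z ∈ U, p z ^ 2 = F z := by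
  have hp : AnalyticOnNhd ℂ (toMeromorphicNFOn k U) U := by
    intro z hz
    rw [← (meromorphicNFOn_toMeromorphicNFOn k U hz).meromorphicOrderAt_nonneg_iff_analyticAt,
      meromorphicOrderAt_toMeromorphicNFOn hk hz]
    -- The order of `k²` is twice that of `k`, so `k` has no pole.
    have h1 : 0 ≤ meromorphicOrderAt (k ^ 2) z := by
      have e : k ^ 2 =ᶠ[𝓝[≠] z] F := h z hz
      rw [meromorphicOrderAt_congr e]
      exact (hF z hz).meromorphicOrderAt_nonneg
    rw [meromorphicOrderAt_pow (hk z hz)] at h1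
    by_contra! hneg
    have htop : meromorphicOrderAt k z ≠ ⊤ := hneg.ne_top
    lift meromorphicOrderAt k z to ℤ using htop with n
    have h2 : (0 : WithTop ℤ) ≤ ((2 * n : ℤ) : WithTop ℤ) := by simpa using h1
    norm_cast at h2 hneg
    omega
  refine ⟨_, hp, fun z hz ↦ hk.toMeromorphicNFOn_eq_self_on_nhdsNE hz, fun z hz ↦ ?_⟩
  have e : (fun w ↦ toMeromorphicNFOn k U w ^ 2) =ᶠ[𝓝[≠] z] F := by
    filter_upwards [hk.toMeromorphicNFOn_eq_self_on_nhdsNE hz, h z hz] with w h1 h2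
    rw [h1, h2]
  exact ((((hp z hz).pow 2).continuousAt.eventuallyEq_nhds_iff_eventuallyEq_nhdsNE
    (hF z hz).continuousAt).1 e).self_of_nhds

/-- On the segment the integrand agrees with its analytic extension off a discrete, hence null, set;
the primitive `P` then evaluates the integral. -/
theorem height_eq {h q p P : ℂ → ℂ} {z₀ z : ℂ} (hz₀ : z₀ ∈ disk) (hz : z ∈ disk)
    (hp : ∀ w ∈ disk, p =ᶠ[𝓝[≠] w] fun w ↦ deriv h w * q w) (hpc : ContinuousOn p disk)
    (hP : ∀ w ∈ disk, HasDerivAt P (p w) w) :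
    height h q z₀ z = 2 * (P z - P z₀).im := by
  rw [height]
  congr 2
  rcases eq_or_ne z z₀ with rfl | hne
  · simp
  set c : ℝ → ℂ := fun t ↦ z₀ + t * (z - z₀) with hc
  have hcm : ∀ t ∈ Set.Icc (0 : ℝ) 1, c t ∈ disk := by
    intro t ht
    have := (convex_ball (0 : ℂ) 1).add_smul_sub_mem hz₀ hz ht
    rw [hc]
    rw [Complex.real_smul] at this
    exact this
  have hcinj : Function.Injective c := by
    intro s t hst
    have : (s : ℂ) * (z - z₀) = t * (z - z₀) := by simpa [hc] using hst
    exact_mod_cast mul_right_cancel₀ (sub_ne_zero.2 hne) this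
  have hcc : Continuous c := by fun_prop
  have hcd : ∀ t, HasDerivAt c (z - z₀) t := fun t ↦ by
    exact HasDerivAt.congr_deriv
      (((Complex.ofRealCLM.hasDerivAt (x := t)).mul_const (z - z₀)).const_add z₀) (by simp)
  have hcod : (fun t ↦ deriv h (c t) * q (c t) * (z - z₀))
      =ᶠ[Filter.codiscreteWithin (Set.uIoc (0 : ℝ) 1)] fun t ↦ p (c t) * (z - z₀) := by
    rw [Filter.EventuallyEq, Filter.Eventually, mem_codiscreteWithin_iff_forall_mem_nhdsNE]
    intro t ht
    rw [Set.uIoc_of_le zero_le_one] at ht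
    have ht' := hcm t (Set.Ioc_subset_Icc_self ht)
    -- Injectivity of `c` keeps punctured neighbourhoods punctured.
    have htend : Filter.Tendsto c (𝓝[≠] t) (𝓝[≠] (c t)) :=
      tendsto_nhdsWithin_of_tendsto_nhds_of_eventually_within _
        (hcc.continuousAt.tendsto.mono_left nhdsWithin_le_nhds)
        (by filter_upwards [self_mem_nhdsWithin] with s hs using fun e ↦ hs (hcinj e))
    filter_upwards [htend.eventually (hp _ ht')] with s hs
    left
    simp only [Set.mem_ofPred_eq]
    rw [hs]
  rw [intervalIntegral.integral_congr_ae_restrict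
    (ae_restrict_le_codiscreteWithin measurableSet_uIoc hcod)]
  have hder : ∀ t ∈ Set.uIcc (0 : ℝ) 1,
      HasDerivAt (fun t ↦ P (c t)) (p (c t) * (z - z₀)) t := by
    intro t ht
    rw [Set.uIcc_of_le zero_le_one] at ht
    exact (hP _ (hcm t ht)).comp t (hcd t)
  rw [intervalIntegral.integral_eq_sub_of_hasDerivAt hder]
  · simp [hc]
  · apply ContinuousOn.intervalIntegrable
    rw [Set.uIcc_of_le zero_le_one]
    exact (hpc.comp hcc.continuousOn hcm).mul continuousOn_const

theorem exists_sqrt_of_ne_zero {F : ℂ → ℂ} {z : ℂ} (hF : AnalyticAt ℂ F z) (h0 : F z ≠ 0) :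
    ∃ a : ℂ → ℂ, AnalyticAt ℂ a z ∧ ∀ᶠ w in 𝓝 z, a w ^ 2 = F w := by
  -- Dividing by `F z` moves the value at `z` to `1`, away from the branch cut.
  have h1 : AnalyticAt ℂ (fun w ↦ F w / F z) z := hF.div analyticAt_const h0
  have h2 : (fun w ↦ F w / F z) z ∈ Complex.slitPlane := by simp [h0]
  refine ⟨fun w ↦ F z ^ (1 / 2 : ℂ) * (F w / F z) ^ (1 / 2 : ℂ),
    analyticAt_const.mul (h1.cpow analyticAt_const h2), .of_forall fun w ↦ ?_⟩
  have e : ∀ x : ℂ, (x ^ (1 / 2 : ℂ)) ^ 2 = x := fun x ↦ by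
    simpa only [one_div, Nat.cast_ofNat] using Complex.cpow_nat_inv_pow x (n := 2) two_ne_zero
  rw [mul_pow, e, e, mul_div_cancel₀ _ h0]

/-- Local spinor representation of the Weierstrass data. -/
theorem exists_spinor {H G p : ℂ → ℂ} {z : ℂ} (hH : AnalyticAt ℂ H z) (hG : AnalyticAt ℂ G z)
    (hp : AnalyticAt ℂ p z) (hpe : ∀ᶠ w in 𝓝 z, p w ^ 2 = H w * G w) (h0 : ‖H z‖ + ‖G z‖ ≠ 0) :
    ∃ a b : ℂ → ℂ, AnalyticAt ℂ a z ∧ AnalyticAt ℂ b z ∧ (a z ≠ 0 ∨ b z ≠ 0) ∧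
      ∀ᶠ w in 𝓝 z, H w = a w ^ 2 ∧ G w = b w ^ 2 ∧ p w = a w * b w := by
  -- Only a nonvanishing one of `H`, `G` is given a root. The other root is `p` divided by it, which
  -- is analytic even at a zero and has the sign that `p = a b` requires.
  by_cases hz : H z = 0
  · have hz' : G z ≠ 0 := by rintro e; simp [hz, e] at h0
    obtain ⟨b, hb, hbe⟩ := exists_sqrt_of_ne_zero hG hz'
    have hb0 : b z ≠ 0 := by
      intro e; apply hz'; rw [← hbe.self_of_nhds, e]; simp
    refine ⟨fun w ↦ p w / b w, b, hp.div hb hb0, hb, Or.inr hb0, ?_⟩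
    filter_upwards [hpe, hbe, hb.continuousAt.eventually_ne hb0] with w h1 h2 h3
    refine ⟨?_, h2.symm, by field_simp⟩
    rw [div_pow, h1, h2, mul_div_cancel_right₀]
    rw [← h2]; positivity
  · obtain ⟨a, ha, hae⟩ := exists_sqrt_of_ne_zero hH hz
    have ha0 : a z ≠ 0 := by
      intro e; apply hz; rw [← hae.self_of_nhds, e]; simp
    refine ⟨a, fun w ↦ p w / a w, ha, hp.div ha ha0, Or.inl ha0, ?_⟩
    filter_upwards [hpe, hae, ha.continuousAt.eventually_ne ha0] with w h1 h2 h3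
    refine ⟨h2.symm, ?_, by field_simp⟩
    rw [div_pow, h1, h2, mul_div_cancel_left₀]
    rw [← h2]; positivity

/-! ### The Weierstrass–Enneper vector and the curvature of lifted curves -/

/-- The vector `(Re (A + B̄), Im (A + B̄), 2 Im C)` of the Weierstrass–Enneper representation. -/
def weierstrassVec (A B C : ℂ) : EuclideanSpace ℝ (Fin 3) :=
  !₂[(A + B).re, (A - B).im, 2 * C.im]

theorem norm_sq_weierstrassVec (A B C : ℂ) :
    ‖weierstrassVec A B C‖ ^ 2 = (A + B).re ^ 2 + (A - B).im ^ 2 + (2 * C.im) ^ 2 := by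
  rw [EuclideanSpace.real_norm_sq_eq, Fin.sum_univ_three]
  simp [weierstrassVec]

theorem weierstrassVec_sub_smul (A B C A' B' C' : ℂ) (r : ℝ) :
    weierstrassVec A B C - r • weierstrassVec A' B' C' =
      weierstrassVec (A - r * A') (B - r * B') (C - r * C') := by
  ext i
  fin_cases i <;> simp [weierstrassVec] <;> ring

theorem _root_.HasDerivAt.weierstrassVec {A B C : ℝ → ℂ} {A' B' C' : ℂ} {t : ℝ}
    (hA : HasDerivAt A A' t) (hB : HasDerivAt B B' t) (hC : HasDerivAt C C' t) :
    HasDerivAt (fun s ↦ weierstrassVec (A s) (B s) (C s)) (weierstrassVec A' B' C') t := by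
  have h1 := Complex.reCLM.hasFDerivAt.comp_hasDerivAt t (hA.add hB)
  have h2 := Complex.imCLM.hasFDerivAt.comp_hasDerivAt t (hA.sub hB)
  have h3 := (Complex.imCLM.hasFDerivAt.comp_hasDerivAt t hC).const_mul 2
  have h : HasDerivAt (fun s ↦ ![(A s + B s).re, (A s - B s).im, 2 * (C s).im])
      ![(A' + B').re, (A' - B').im, 2 * C'.im] t := by
    rw [hasDerivAt_pi]
    intro i
    fin_cases i
    · exact h1
    · exact h2
    · exact h3
  exact ((PiLp.continuousLinearEquiv 2 ℝ fun _ : Fin 3 ↦ ℝ).symm :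
    (Fin 3 → ℝ) →L[ℝ] EuclideanSpace ℝ (Fin 3)).hasFDerivAt.comp_hasDerivAt t h

theorem continuous_weierstrassVec :
    Continuous fun x : ℂ × ℂ × ℂ ↦ weierstrassVec x.1 x.2.1 x.2.2 := by
  unfold weierstrassVec
  fun_prop

/-- Conformality of the lift, with factor `e^σ = |a|² + |b|²`; it rests on `a² b² = (a b)²`. -/
theorem norm_weierstrassVec_spinor (a b ζ : ℂ) :
    ‖weierstrassVec (a ^ 2 * ζ) (b ^ 2 * ζ) (a * b * ζ)‖ = (‖a‖ ^ 2 + ‖b‖ ^ 2) * ‖ζ‖ := by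
  rw [← sq_eq_sq₀ (norm_nonneg _) (by positivity), norm_sq_weierstrassVec,
    mul_pow (‖a‖ ^ 2 + ‖b‖ ^ 2)]
  simp only [← Complex.normSq_eq_norm_sq, Complex.normSq_apply]
  simp only [pow_two, Complex.add_re,
    Complex.sub_im, Complex.mul_re, Complex.mul_im]
  ring

/-- Pythagoras: the `β` terms form a multiple of the tangent vector in the direction `iζ`, and the
`ν` terms form `2 Im ν` times a surface normal of length `|a|² + |b|²`. -/
theorem norm_sq_weierstrassVec_normal (a b ζ ν : ℂ) (β : ℝ) :
    ‖weierstrassVec (2 * Complex.I * β * (a ^ 2 * ζ) - 2 * ν * (a * conj b))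
      (2 * Complex.I * β * (b ^ 2 * ζ) + 2 * ν * (b * conj a))
      (2 * Complex.I * β * (a * b * ζ) + ν * (a * conj a - b * conj b))‖ ^ 2 =
    (‖a‖ ^ 2 + ‖b‖ ^ 2) ^ 2 * (4 * β ^ 2 * ‖ζ‖ ^ 2 + 4 * ν.im ^ 2) := by
  rw [norm_sq_weierstrassVec]
  simp only [← Complex.normSq_eq_norm_sq, Complex.normSq_apply]
  simp only [pow_two, Complex.add_re,
    Complex.add_im, Complex.sub_re, Complex.sub_im, Complex.mul_re, Complex.mul_im, Complex.I_re,
    Complex.I_im, Complex.ofReal_re, Complex.ofReal_im, Complex.conj_re, Complex.conj_im,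
    Complex.re_ofNat, Complex.im_ofNat]
  ring

/-- The curvature term of the lift of a geodesic: geodesic curvature plus normal curvature, the
latter being bounded by the Gauss curvature because the surface is minimal. -/
theorem curvature_sq_le {a b a' b' l m R ζ : ℂ} (hab : 0 < ‖a‖ ^ 2 + ‖b‖ ^ 2) (hζ : ζ ≠ 0)
    (ha' : a' = l * a - m * conj b) (hb' : b' = l * b + m * conj a) :
    (‖weierstrassVec (2 * a * a' * ζ * ζ + a ^ 2 * (-2 * R * ζ ^ 2))
        (2 * b * b' * ζ * ζ + b ^ 2 * (-2 * R * ζ ^ 2))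
        ((a' * b + a * b') * ζ * ζ + a * b * (-2 * R * ζ ^ 2))
      - (2 * ((l - R) * ζ).re) • weierstrassVec (a ^ 2 * ζ) (b ^ 2 * ζ) (a * b * ζ)‖
      / ‖weierstrassVec (a ^ 2 * ζ) (b ^ 2 * ζ) (a * b * ζ)‖) ^ 2
      ≤ 4 * ((l - R) * ζ).im ^ 2 + 4 * ‖m‖ ^ 2 * ‖ζ‖ ^ 2 := by
  have hk : (l - R) * ζ = (((l - R) * ζ).re : ℂ) + (((l - R) * ζ).im : ℂ) * Complex.I :=
    (Complex.re_add_im _).symm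
  set x := ((l - R) * ζ).re
  set y := ((l - R) * ζ).im
  have hv : weierstrassVec (2 * a * a' * ζ * ζ + a ^ 2 * (-2 * R * ζ ^ 2))
        (2 * b * b' * ζ * ζ + b ^ 2 * (-2 * R * ζ ^ 2))
        ((a' * b + a * b') * ζ * ζ + a * b * (-2 * R * ζ ^ 2))
      - (2 * x) • weierstrassVec (a ^ 2 * ζ) (b ^ 2 * ζ) (a * b * ζ) =
      -- Subtracting `2x` times the velocity leaves the rotated tangent with coefficient `2y`
      -- (geodesic curvature) and the surface normal with `ν = m ζ²` (normal curvature).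
      weierstrassVec (2 * Complex.I * y * (a ^ 2 * ζ) - 2 * (m * ζ ^ 2) * (a * conj b))
      (2 * Complex.I * y * (b ^ 2 * ζ) + 2 * (m * ζ ^ 2) * (b * conj a))
      (2 * Complex.I * y * (a * b * ζ) + (m * ζ ^ 2) * (a * conj a - b * conj b)) := by
    rw [weierstrassVec_sub_smul, ha', hb']
    push_cast
    congr 1
    · linear_combination (2 * a ^ 2 * ζ) * hk
    · linear_combination (2 * b ^ 2 * ζ) * hk
    · linear_combination (2 * a * b * ζ) * hk
  have hζ' : 0 < ‖ζ‖ := norm_pos_iff.2 hζ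
  rw [hv, div_pow, norm_sq_weierstrassVec_normal, norm_weierstrassVec_spinor, mul_pow,
    mul_div_mul_left _ _ (by positivity), div_le_iff₀ (by positivity)]
  have h1 : (m * ζ ^ 2).im ^ 2 ≤ ‖m * ζ ^ 2‖ ^ 2 := by
    rw [← sq_abs]
    exact pow_le_pow_left₀ (abs_nonneg _) (Complex.abs_im_le_norm _) 2
  rw [norm_mul, norm_pow] at h1
  nlinarith [h1]

/-- The Schwarzian of a curve, written by means of the tensors of the two metrics. -/
theorem schwarzian_algebra (szz sz rzz rz ζ : ℂ) (sm rm : ℝ) :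
    (2 * (szz * ζ ^ 2 + sz * (-2 * rz * ζ ^ 2)).re + 2 * sm * ‖ζ‖ ^ 2)
      - (2 * (rzz * ζ ^ 2 + rz * (-2 * rz * ζ ^ 2)).re + 2 * rm * ‖ζ‖ ^ 2)
      - 1 / 2 * (2 * ((sz - rz) * ζ).re) ^ 2
      + 1 / 2 * (4 * ((sz - rz) * ζ).im ^ 2 + 4 * sm * ‖ζ‖ ^ 2) =
    ((2 * (szz - sz ^ 2) - 2 * (rzz - rz ^ 2)) * ζ ^ 2).re + (4 * sm - 2 * rm) * ‖ζ‖ ^ 2 := by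
  simp only [pow_two, Complex.add_re, Complex.sub_re, Complex.sub_im, Complex.mul_re, Complex.mul_im, Complex.neg_re,
    Complex.neg_im, Complex.re_ofNat, Complex.im_ofNat]
  ring

/-! ### Geodesics of the conformal metric -/

section Geodesic

variable {ρ : ℂ → ℝ} {γ : ℝ → ℂ}

theorem _root_.DifferentiableOn.hasDerivAt_derivWithin_Icc {E : Type*} [NormedAddCommGroup E]
    [NormedSpace ℝ E] {f : ℝ → E} (hf : DifferentiableOn ℝ f (Set.Icc 0 1)) {t : ℝ}
    (ht : t ∈ Set.Ioo (0 : ℝ) 1) : HasDerivAt f (derivWithin f (Set.Icc 0 1) t) t :=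
  (hf t (Set.Ioo_subset_Icc_self ht)).hasDerivWithinAt.hasDerivAt (Icc_mem_nhds ht.1 ht.2)

namespace IsGeodesic

theorem contDiffOn_derivWithin (h : IsGeodesic ρ γ) :
    ContDiffOn ℝ 1 (derivWithin γ (Set.Icc 0 1)) (Set.Icc 0 1) :=
  h.contDiffOn.derivWithin (uniqueDiffOn_Icc zero_lt_one) (by norm_num)

theorem hasDerivAt (h : IsGeodesic ρ γ) {t : ℝ} (ht : t ∈ Set.Ioo (0 : ℝ) 1) :
    HasDerivAt γ (derivWithin γ (Set.Icc 0 1) t) t :=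
  DifferentiableOn.hasDerivAt_derivWithin_Icc (h.contDiffOn.differentiableOn (by norm_num)) ht

theorem hasDerivAt_derivWithin (h : IsGeodesic ρ γ) {t : ℝ} (ht : t ∈ Set.Ioo (0 : ℝ) 1) :
    HasDerivAt (derivWithin γ (Set.Icc 0 1))
      (-2 * dz (toC ρ) (γ t) * derivWithin γ (Set.Icc 0 1) t ^ 2) t := by
  have := DifferentiableOn.hasDerivAt_derivWithin_Icc
    (h.contDiffOn_derivWithin.differentiableOn (by norm_num)) ht
  refine this.congr_deriv ?_
  linear_combination h.equation t (Set.Ioo_subset_Icc_self ht)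

/-- Geodesics have constant speed. -/
theorem exists_speed (h : IsGeodesic ρ γ) (hρ : ContDiffOn ℝ 2 ρ disk) (hne : γ 0 ≠ γ 1) :
    ∃ c : ℝ, 0 < c ∧ ∀ t ∈ Set.Icc (0 : ℝ) 1,
      Real.exp (ρ (γ t)) * ‖derivWithin γ (Set.Icc 0 1) t‖ = c := by
  set ζ := derivWithin γ (Set.Icc 0 1) with hζ
  set S : ℝ → ℝ := fun t ↦ Real.exp (ρ (γ t)) ^ 2 * ‖ζ t‖ ^ 2 with hS
  have hζc : ContinuousOn ζ (Set.Icc 0 1) := h.contDiffOn_derivWithin.continuousOn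
  have hρc : ContinuousOn (fun t ↦ ρ (γ t)) (Set.Icc 0 1) :=
    hρ.continuousOn.comp h.contDiffOn.continuousOn h.mem_disk
  have hSc : ContinuousOn S (Set.Icc 0 1) := (hρc.rexp.pow 2).mul (hζc.norm.pow 2)
  -- The growth `4 Re (ρ_z ζ)` of `e^{2ρ}` relative to itself cancels that of `|ζ|²`, by `ζ' = -2
  -- ρ_z ζ²`.
  have hSd : ∀ t ∈ Set.Ioo (0 : ℝ) 1, HasDerivAt S 0 t := by
    intro t ht
    have hρt : DifferentiableAt ℝ ρ (γ t) :=
      (hρ.contDiffAt (isOpen_disk.mem_nhds (h.mem_disk t (Set.Ioo_subset_Icc_self ht)))).differentiableAt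
        (by norm_num)
    have h1 := hasDerivAt_comp_curve (γ' := ζ) hρt (h.hasDerivAt ht)
    have h2 := (h.hasDerivAt_derivWithin ht).norm_sq
    refine ((h1.exp.pow 2).mul h2).congr_deriv ?_
    rw [← hζ, Complex.inner, ← Complex.normSq_eq_norm_sq, Complex.normSq_apply]
    simp [pow_two]
    ring
  have hconst : ∀ t ∈ Set.Icc (0 : ℝ) 1, S t = S 0 := by
    intro t ht
    rcases ht.1.eq_or_lt with rfl | h0
    · rfl
    obtain ⟨x, hx, e⟩ := exists_hasDerivAt_eq_slope S (fun _ ↦ 0) h0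
      (hSc.mono (Set.Icc_subset_Icc_right ht.2)) fun x hx ↦ hSd x ⟨hx.1, hx.2.trans_le ht.2⟩
    have : t - 0 ≠ 0 := by linarith
    field_simp at e
    linarith
  have hsq : ∀ t ∈ Set.Icc (0 : ℝ) 1,
      Real.exp (ρ (γ t)) * ‖ζ t‖ = Real.exp (ρ (γ 0)) * ‖ζ 0‖ := by
    intro t ht
    rw [← sq_eq_sq₀ (by positivity) (by positivity), mul_pow, mul_pow]
    exact hconst t ht
  refine ⟨_, ?_, hsq⟩
  -- Zero speed would make `γ` constant, although its endpoints differ.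
  by_contra! hle
  apply hne
  have hz : ∀ t ∈ Set.Icc (0 : ℝ) 1, ζ t = 0 := by
    intro t ht
    have h1 := (hsq t ht).le.trans hle
    have h2 : ‖ζ t‖ ≤ 0 := by
      by_contra! h3
      have := mul_pos (Real.exp_pos (ρ (γ t))) h3
      linarith
    exact norm_le_zero_iff.1 h2
  exact (constant_of_derivWithin_zero (h.contDiffOn.differentiableOn (by norm_num))
    (fun t ht ↦ hz t (Set.Ico_subset_Icc_self ht)) 1 (by simp)).symm

end IsGeodesic

theorem conformalLength_eq {c : ℝ} (hc : ∀ t ∈ Set.Icc (0 : ℝ) 1,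
      Real.exp (ρ (γ t)) * ‖derivWithin γ (Set.Icc 0 1) t‖ = c) :
    conformalLength ρ γ = ENNReal.ofReal c := by
  rw [conformalLength, MeasureTheory.setLIntegral_congr_fun measurableSet_Icc
    (g := fun _ ↦ ENNReal.ofReal c) fun t ht ↦ by simp only [hc t ht]]
  simp

end Geodesic

/-! ### The Schwarzian estimate along a geodesic -/

/-- The surface data near a point of the disk: the conformal factor, its derivatives and the
derivatives of the Weierstrass data, in terms of a local spinor. -/
theorem exists_local_data {h g p : ℂ → ℂ} {z : ℂ} (hz : z ∈ disk)
    (hh : AnalyticOnNhd ℂ h disk) (hg : AnalyticOnNhd ℂ g disk) (hp : AnalyticOnNhd ℂ p disk)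
    (hpe : ∀ w ∈ disk, p w ^ 2 = deriv h w * deriv g w)
    (hreg : ‖deriv h z‖ + ‖deriv g z‖ ≠ 0) :
    ContDiffAt ℝ 2 (sigma h g) z ∧ ∃ a b a' b' m : ℂ,
      0 < ‖a‖ ^ 2 + ‖b‖ ^ 2 ∧ deriv h z = a ^ 2 ∧ deriv g z = b ^ 2 ∧ p z = a * b ∧
      deriv (deriv h) z = 2 * a * a' ∧ deriv (deriv g) z = 2 * b * b' ∧
      deriv p z = a' * b + a * b' ∧ a' = dz (toC (sigma h g)) z * a - m * conj b ∧
      b' = dz (toC (sigma h g)) z * b + m * conj a ∧ mixedDeriv (sigma h g) z = ‖m‖ ^ 2 := by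
  obtain ⟨a, b, ha, hb, h0, he⟩ := exists_spinor (hh z hz).deriv (hg z hz).deriv (hp z hz)
    (by filter_upwards [isOpen_disk.mem_nhds hz] with w hw using hpe w hw) hreg
  have hpos : 0 < ‖a z‖ ^ 2 + ‖b z‖ ^ 2 := by
    rcases h0 with h0 | h0
    · have := norm_pos_iff.2 h0; positivity
    · have := norm_pos_iff.2 h0; positivity
  have hE := spinorEnergy_pos_iff.1 hpos
  have hs : sigma h g =ᶠ[𝓝 z] fun w ↦ Real.log (‖a w‖ ^ 2 + ‖b w‖ ^ 2) := by
    filter_upwards [he] with w hw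
    rw [sigma, hw.1, hw.2.1, norm_pow, norm_pow]
  have hda := ha.differentiableAt.hasDerivAt
  have hdb := hb.differentiableAt.hasDerivAt
  have e1 : deriv h =ᶠ[𝓝 z] fun w ↦ a w ^ 2 := he.mono fun w hw ↦ hw.1
  have e2 : deriv g =ᶠ[𝓝 z] fun w ↦ b w ^ 2 := he.mono fun w hw ↦ hw.2.1
  have e3 : p =ᶠ[𝓝 z] fun w ↦ a w * b w := he.mono fun w hw ↦ hw.2.2
  refine ⟨contDiffAt_log_energy ha hb hE hs, a z, b z, deriv a z, deriv b z,
    (a z * deriv b z - deriv a z * b z) / spinorEnergy a b z, hpos, he.self_of_nhds.1,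
    he.self_of_nhds.2.1, he.self_of_nhds.2.2, ?_, ?_, ?_, ?_, ?_,
    mixedDeriv_log_energy ha hb hE hs⟩
  · rw [e1.deriv_eq]; simpa using (hda.fun_pow 2).deriv
  · rw [e2.deriv_eq]; simpa using (hdb.fun_pow 2).deriv
  · rw [e3.deriv_eq]; exact (hda.fun_mul hdb).deriv
  · rw [dz_toC_log_energy ha.differentiableAt hb.differentiableAt hE hs]
    field_simp
    rw [spinorEnergy]
    ring
  · rw [dz_toC_log_energy ha.differentiableAt hb.differentiableAt hE hs]
    field_simp
    rw [spinorEnergy]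
    ring

theorem sq_mul_toReal_inv_lt_one {c : ℝ} {δ : ℝ≥0∞} (hc : 0 < c) (h : ENNReal.ofReal c < δ) :
    (c * (δ⁻¹).toReal) ^ 2 < 1 := by
  have h1 : c * (δ⁻¹).toReal < 1 := by
    rcases eq_or_ne δ ⊤ with rfl | hδ
    · simp
    · have h2 : c < δ.toReal := (ENNReal.ofReal_lt_iff_lt_toReal hc.le hδ).1 h
      rw [ENNReal.toReal_inv, ← div_eq_mul_inv, div_lt_one (hc.trans h2)]
      exact h2
  have h0 : 0 ≤ c * (δ⁻¹).toReal := by positivity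
  nlinarith

/-- The lift takes different values at the endpoints of a short geodesic. -/
theorem lift_ne_of_isGeodesic {h g p P : ℂ → ℂ} {ρ : ℂ → ℝ} {δ : ℝ≥0∞} {γ : ℝ → ℂ} (A : ℂ)
    (hh : AnalyticOnNhd ℂ h disk) (hg : AnalyticOnNhd ℂ g disk) (hp : AnalyticOnNhd ℂ p disk)
    (hpe : ∀ w ∈ disk, p w ^ 2 = deriv h w * deriv g w)
    (hP : ∀ w ∈ disk, HasDerivAt P (p w) w)
    (hreg : ∀ z ∈ disk, ‖deriv h z‖ + ‖deriv g z‖ ≠ 0)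
    (hρ : ContDiffOn ℝ 2 ρ disk)
    (hmain : ∀ z ∈ disk,
      ‖harmonicSchwarzian h g z - schwarzianTensor ρ z‖
          + Real.exp (2 * sigma h g z) * |gaussCurvature h g z|
        ≤ 2 * Real.pi ^ 2 * Real.exp (2 * ρ z) * (δ⁻¹).toReal ^ 2 + 2 * mixedDeriv ρ z)
    (hγ : IsGeodesic ρ γ) (hne : γ 0 ≠ γ 1) (hlen : conformalLength ρ γ < δ) :
    weierstrassVec (h (γ 0)) (g (γ 0)) (P (γ 0) - A) ≠
      weierstrassVec (h (γ 1)) (g (γ 1)) (P (γ 1) - A) := by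
  obtain ⟨c, hc0, hc⟩ := hγ.exists_speed hρ hne
  rw [conformalLength_eq hc] at hlen
  have hc1 := sq_mul_toReal_inv_lt_one hc0 hlen
  set ζ := derivWithin γ (Set.Icc 0 1) with hζ
  have hγc := hγ.contDiffOn.continuousOn
  have hm : ∀ t ∈ Set.Ioo (0 : ℝ) 1, γ t ∈ disk := fun t ht ↦
    hγ.mem_disk t (Set.Ioo_subset_Icc_self ht)
  have hγd : ∀ t ∈ Set.Ioo (0 : ℝ) 1, HasDerivAt γ (ζ t) t := fun t ht ↦ hγ.hasDerivAt ht
  have hζd : ∀ t ∈ Set.Ioo (0 : ℝ) 1, HasDerivAt ζ (-2 * dz (toC ρ) (γ t) * ζ t ^ 2) t :=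
    fun t ht ↦ hγ.hasDerivAt_derivWithin ht
  have hρd : ∀ t ∈ Set.Ioo (0 : ℝ) 1, ContDiffAt ℝ 2 ρ (γ t) := fun t ht ↦
    hρ.contDiffAt (isOpen_disk.mem_nhds (hm t ht))
  have hσd : ∀ t ∈ Set.Ioo (0 : ℝ) 1, ContDiffAt ℝ 2 (sigma h g) (γ t) := fun t ht ↦
    (exists_local_data (hm t ht) hh hg hp hpe (hreg _ (hm t ht))).1
  have hcomp : ∀ {F : ℂ → ℂ}, (∀ z ∈ disk, DifferentiableAt ℂ F z) → ∀ t ∈ Set.Ioo (0 : ℝ) 1,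
      HasDerivAt (fun s ↦ F (γ s)) (deriv F (γ t) * ζ t) t := fun hF t ht ↦
    (hF _ (hm t ht)).hasDerivAt.comp_of_eq t (hγd t ht) rfl
  have hcont : ∀ {F : ℂ → ℂ}, (∀ z ∈ disk, DifferentiableAt ℂ F z) →
      ContinuousOn (fun s ↦ F (γ s)) (Set.Icc 0 1) := fun hF t ht ↦
    (hF _ (hγ.mem_disk t ht)).continuousAt.comp_continuousWithinAt (hγc t ht)
  have dh : ∀ z ∈ disk, DifferentiableAt ℂ h z := fun z hz ↦ (hh z hz).differentiableAt
  have dg : ∀ z ∈ disk, DifferentiableAt ℂ g z := fun z hz ↦ (hg z hz).differentiableAt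
  have dh' : ∀ z ∈ disk, DifferentiableAt ℂ (deriv h) z := fun z hz ↦
    (hh z hz).deriv.differentiableAt
  have dg' : ∀ z ∈ disk, DifferentiableAt ℂ (deriv g) z := fun z hz ↦
    (hg z hz).deriv.differentiableAt
  have dp : ∀ z ∈ disk, DifferentiableAt ℂ p z := fun z hz ↦ (hp z hz).differentiableAt
  have dP : ∀ z ∈ disk, DifferentiableAt ℂ P z := fun z hz ↦ (hP z hz).differentiableAt
  have hexp : ∀ z ∈ disk, Real.exp (sigma h g z) = ‖deriv h z‖ + ‖deriv g z‖ := fun z hz ↦ by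
    rw [sigma, Real.exp_log (lt_of_le_of_ne (by positivity) (hreg z hz).symm)]
  -- The speed of the lifted curve is `e^σ |ζ|` with `|ζ| = c e^{-ρ}`, so its logarithm is `σ - ρ +
  -- log c`. Second derivatives of `γ` are replaced throughout by means of the geodesic equation.
  refine ne_of_curve_schwarzian_le (P := Real.pi ^ 2 * (c * (δ⁻¹).toReal) ^ 2)
    (Φ := fun t ↦ weierstrassVec (h (γ t)) (g (γ t)) (P (γ t) - A))
    (Φ' := fun t ↦ weierstrassVec (deriv h (γ t) * ζ t) (deriv g (γ t) * ζ t) (p (γ t) * ζ t))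
    (Φ'' := fun t ↦ weierstrassVec
      (deriv (deriv h) (γ t) * ζ t * ζ t + deriv h (γ t) * (-2 * dz (toC ρ) (γ t) * ζ t ^ 2))
      (deriv (deriv g) (γ t) * ζ t * ζ t + deriv g (γ t) * (-2 * dz (toC ρ) (γ t) * ζ t ^ 2))
      (deriv p (γ t) * ζ t * ζ t + p (γ t) * (-2 * dz (toC ρ) (γ t) * ζ t ^ 2)))
    (l := fun t ↦ sigma h g (γ t) - ρ (γ t) + Real.log c)
    (l' := fun t ↦ 2 * (dz (toC (sigma h g)) (γ t) * ζ t).re - 2 * (dz (toC ρ) (γ t) * ζ t).re)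
    (l'' := fun t ↦
      (2 * (dz (dz (toC (sigma h g))) (γ t) * ζ t ^ 2
          + dz (toC (sigma h g)) (γ t) * (-2 * dz (toC ρ) (γ t) * ζ t ^ 2)).re
        + 2 * mixedDeriv (sigma h g) (γ t) * ‖ζ t‖ ^ 2)
      - (2 * (dz (dz (toC ρ)) (γ t) * ζ t ^ 2
          + dz (toC ρ) (γ t) * (-2 * dz (toC ρ) (γ t) * ζ t ^ 2)).re
        + 2 * mixedDeriv ρ (γ t) * ‖ζ t‖ ^ 2))
    ?_ ?_ ?_ ?_ ?_ ?_ ?_ ?_ ?_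
  · have := Real.pi_pos
    exact mul_lt_of_lt_one_right (by positivity) hc1
  · exact continuous_weierstrassVec.comp_continuousOn
      ((hcont dh).prodMk ((hcont dg).prodMk ((hcont dP).sub continuousOn_const)))
  · refine ContinuousOn.add (ContinuousOn.sub ?_ (hρ.continuousOn.comp hγc hγ.mem_disk))
      continuousOn_const
    exact ((hcont dh').norm.add (hcont dg').norm).log fun t ht ↦ hreg _ (hγ.mem_disk t ht)
  · intro t ht
    refine (hcomp dh t ht).weierstrassVec (hcomp dg t ht) ?_
    rw [← (hP _ (hm t ht)).deriv]
    exact (hcomp dP t ht).sub_const A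
  · intro t ht
    exact ((hcomp dh' t ht).mul (hζd t ht)).weierstrassVec ((hcomp dg' t ht).mul (hζd t ht))
      ((hcomp dp t ht).mul (hζd t ht))
  · intro t ht
    exact ((hasDerivAt_comp_curve (γ' := ζ) ((hσd t ht).differentiableAt (by norm_num))
      (hγd t ht)).sub (hasDerivAt_comp_curve (γ' := ζ)
        ((hρd t ht).differentiableAt (by norm_num)) (hγd t ht))).add_const _
  · intro t ht
    exact (hasDerivAt_deriv_comp_curve (hσd t ht) (hγd t ht) (hζd t ht)).sub
      (hasDerivAt_deriv_comp_curve (hρd t ht) (hγd t ht) (hζd t ht))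
  · intro t ht
    obtain ⟨-, a, b, a', b', m, hab, e1, e2, e3, -⟩ :=
      exists_local_data (hm t ht) hh hg hp hpe (hreg _ (hm t ht))
    rw [Real.exp_add, Real.exp_sub, Real.exp_log hc0, hexp _ (hm t ht), e1, e2, e3,
      norm_weierstrassVec_spinor, norm_pow, norm_pow, ← hc t (Set.Ioo_subset_Icc_self ht)]
    field_simp
  · intro t ht
    obtain ⟨-, a, b, a', b', m, hab, e1, e2, e3, e4, e5, e6, ea, eb, em⟩ :=
      exists_local_data (hm t ht) hh hg hp hpe (hreg _ (hm t ht))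
    have hct := hc t (Set.Ioo_subset_Icc_self ht)
    have hζ0 : ζ t ≠ 0 := by
      intro e; rw [e, norm_zero, mul_zero] at hct; exact hc0.ne hct
    have hcurv := curvature_sq_le (R := dz (toC ρ) (γ t)) hab hζ0 ea eb
    have hl : 2 * (dz (toC (sigma h g)) (γ t) * ζ t).re - 2 * (dz (toC ρ) (γ t) * ζ t).re =
        2 * ((dz (toC (sigma h g)) (γ t) - dz (toC ρ) (γ t)) * ζ t).re := by
      rw [sub_mul, Complex.sub_re]; ring
    rw [hl, e1, e2, e3, e4, e5, e6]
    rw [← em] at hcurv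
    have hid := schwarzian_algebra (dz (dz (toC (sigma h g))) (γ t)) (dz (toC (sigma h g)) (γ t))
      (dz (dz (toC ρ)) (γ t)) (dz (toC ρ) (γ t)) (ζ t) (mixedDeriv (sigma h g) (γ t))
      (mixedDeriv ρ (γ t))
    -- Here `K ≤ 0`, because `Δσ = 4 σ_{z z̄} = 4 |m|²`.
    have hK : Real.exp (2 * sigma h g (γ t)) * |gaussCurvature h g (γ t)| =
        4 * mixedDeriv (sigma h g) (γ t) := by
      rw [gaussCurvature, laplacian_eq_four_mul_mixedDeriv (hσd t ht), abs_mul, abs_neg,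
        Real.abs_exp, ← mul_assoc, ← Real.exp_add, em, abs_of_nonneg (by positivity)]
      simp
    have hM := hmain _ (hm t ht)
    rw [hK, harmonicSchwarzian] at hM
    have hD : ((2 * (dz (dz (toC (sigma h g))) (γ t) - dz (toC (sigma h g)) (γ t) ^ 2)
        - 2 * (dz (dz (toC ρ)) (γ t) - dz (toC ρ) (γ t) ^ 2)) * ζ t ^ 2).re ≤
        ‖schwarzianTensor (sigma h g) (γ t) - schwarzianTensor ρ (γ t)‖ * ‖ζ t‖ ^ 2 := by
      refine (Complex.re_le_norm _).trans ?_
      rw [norm_mul, norm_pow]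
      rfl
    have hM2 := mul_le_mul_of_nonneg_right hM (sq_nonneg ‖ζ t‖)
    have hE : Real.exp (2 * ρ (γ t)) = Real.exp (ρ (γ t)) ^ 2 := by
      rw [← Real.exp_nat_mul]; norm_num
    have hfin : 2 * Real.pi ^ 2 * Real.exp (2 * ρ (γ t)) * (δ⁻¹).toReal ^ 2 * ‖ζ t‖ ^ 2 =
        2 * (Real.pi ^ 2 * (c * (δ⁻¹).toReal) ^ 2) := by
      rw [hE, ← hct]; ring
    linarith

end WELift

end

/-! ### The injectivity criterion -/

theorem theorem4p1 (f h g q : ℂ → ℂ) (z₀ : ℂ) (hz₀ : z₀ ∈ WELift.disk)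
    (hf : InnerProductSpace.HarmonicOnNhd f WELift.disk)
    (hdec : WELift.IsCanonicalDecomposition f h g z₀)
    (hreg : ∀ z ∈ WELift.disk, ‖deriv h z‖ + ‖deriv g z‖ ≠ 0)
    (hq : MeromorphicOn q WELift.disk)
    (hω : WELift.dilatation h g =ᶠ[Filter.codiscreteWithin WELift.disk] fun z ↦ q z ^ 2)
    (ρ : ℂ → ℝ) (hρ : ContDiffOn ℝ 2 ρ WELift.disk)
    (δ : ℝ≥0∞) (hδ : 0 < δ) (hgeo : WELift.JoinedByGeodesics ρ δ)
    -- the factor `1 / δ²` is `0` for `δ = ∞`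
    (hmain : ∀ z ∈ WELift.disk,
      ‖WELift.harmonicSchwarzian h g z - WELift.schwarzianTensor ρ z‖
          + Real.exp (2 * WELift.sigma h g z) * |WELift.gaussCurvature h g z|
        ≤ 2 * Real.pi ^ 2 * Real.exp (2 * ρ z) * (δ⁻¹).toReal ^ 2
          + 2 * WELift.mixedDeriv ρ z) :
    Set.InjOn (WELift.lift f h q z₀) WELift.disk := by
  have hh := hdec.analytic_h
  have hg := hdec.analytic_g
  have hsq : ∀ z ∈ WELift.disk,
      ∀ᶠ w in 𝓝[≠] z, (deriv h w * q w) ^ 2 = deriv h w * deriv g w := by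
    intro z hz
    have h1 := mem_codiscreteWithin_iff_forall_mem_nhdsNE.1 hω z hz
    filter_upwards [h1, nhdsWithin_le_nhds (WELift.isOpen_disk.mem_nhds hz)] with w hw hwd
    have hw' : WELift.dilatation h g w = q w ^ 2 := hw.resolve_right fun hn ↦ hn hwd
    rw [mul_pow, ← hw', WELift.dilatation]
    -- Where `h'` vanishes both sides are zero, whatever value the dilatation has there.
    by_cases h0 : deriv h w = 0
    · simp [h0]
    · field_simp
  obtain ⟨p, hp, hpk, hpe⟩ := WELift.exists_analyticOnNhd_of_sq_eventuallyEq
    (k := fun w ↦ deriv h w * q w) (F := fun w ↦ deriv h w * deriv g w)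
    (fun z hz ↦ (hh z hz).deriv.meromorphicAt.mul (hq z hz))
    (fun z hz ↦ (hh z hz).deriv.mul (hg z hz).deriv) hsq
  obtain ⟨P, hP⟩ : ∃ P : ℂ → ℂ, ∀ w ∈ WELift.disk, HasDerivAt P (p w) w :=
    DifferentiableOn.isExactOn_ball hp.differentiableOn
  have hlift : ∀ z ∈ WELift.disk,
      WELift.lift f h q z₀ z = WELift.weierstrassVec (h z) (g z) (P z - P z₀) := by
    intro z hz
    rw [WELift.lift, WELift.weierstrassVec, hdec.eq_add z hz,
      WELift.height_eq hz₀ hz hpk hp.continuousOn hP]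
    simp [sub_eq_add_neg]
  intro z₁ hz₁ z₂ hz₂ heq
  by_contra hne
  obtain ⟨γ, hγ, rfl, rfl, hlen⟩ := hgeo z₁ hz₁ z₂ hz₂ hne
  rw [hlift _ hz₁, hlift _ hz₂] at heq
  exact WELift.lift_ne_of_isGeodesic (P z₀) hh hg hp hpe hP hreg hρ hmain hγ hne hlen heq
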